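/- **Setting.** Let $V=\{1,\dots,n\}$. A polymatroid function is a function $f:2^V\to\mathbb R$ with $f(\emptyset)=0$ that is monotone non-decreasing and submodular; if $f(\{j\})>0$ for all $j$, its (total) curvature is $\kappa_f=1-\min_{j\in V}\frac{f(V)-f(V\setminus\{j\})}{f(\{j\})}$. Consider pairs $(f,g)$ of polymatroid functions on $V$, positive on singletons, with $\kappa_f=\kappa$, and the problems * SCSC: $\min\{f(X): g(X)\ge c\}$, where $\min_j g(\{j\})\le c\le g(V)$; * SCSK: $\max\{g(X): f(X)\le b\}$, where $\min_j f(\{j\})\le b\le f(V)$. With $X^*$ an optimizer, a set $X$ is a $[\sigma,\rho]$ bi-criterion solution of SCSC if $f(X)\le\sigma f(X^*)$ and $g(X)\ge\rho c$, and a $[\rho,\sigma]$ bi-criterion solution of SCSK if $g(X)\ge\rho\, g(X^*)$ and $f(X)\le\sigma b$. An algorithm is given $n$ and the parameter ($c$, respectively $b$), and has access to $f$ and $g$ through value oracles: it adaptively queries values $f(S)$, $g(S)$, may toss fair coins, and outputs a set; it is otherwise computationally unrestricted. The size of an instance is $n+\lceil\log_2\frac{f(V)}{\min_j f(\{j\})}\rceil+\lceil\log_2\frac{g(V)}{\min_j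 g(\{j\})}\rceil$. **Theorem.** Let $0<\kappa\le 1$, $\varepsilon>0$, $\delta>0$, and let $p$ be a polynomial with natural-number coefficients. There is an $N$ such that for all $n\ge N$, all real $\sigma$ and all $\rho>0$ with $$\frac{\sigma}{\rho}<\frac{n^{1/2-\varepsilon}}{1+(n^{1/2-\varepsilon}-1)(1-\kappa)}$$ the following holds. 1. There is no algorithm that, on every instance of SCSC on $V=\{1,\dots,n\}$ with $\kappa_f=\kappa$ as above, makes at most $p(\text{size})$ queries and outputs a $[\sigma,\rho]$ bi-criterion solution with probability at least $\delta$. 2. There is no algorithm that, on every instance of SCSK on $V=\{1,\dots,n\}$ with $\kappa_f=\kappa$ as above, makes at most $p(\text{size})$ queries and outputs a $[\rho,\sigma]$ bi-criterion solution with probability at least $\delta$. In particular (deterministic algorithms, $\delta=1$), no polynomial time algorithm with value oracles for $f$ and $g$ is guaranteed to achieve, for SCSC or for SCSK with cost functions of curvature $\kappa$, a bi-criterion factor $\sigma/\rho$ better than $\frac{n^{1/2-\varepsilon}}{1+(n^{1/2-\varepsilon}-1)(1-\kappa)}$. -/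

import Mathlib

namespace SubmodularHardness

/-- A polymatroid function on the subsets of the ground set `Fin n`: a normalized, monotone
non-decreasing, submodular set function. -/
structure IsPolymatroid {n : ℕ} (f : Finset (Fin n) → ℝ) : Prop where
  empty : f ∅ = 0
  mono : ∀ S T : Finset (Fin n), S ⊆ T → f S ≤ f T
  submodular : ∀ S T : Finset (Fin n), f (S ∪ T) + f (S ∩ T) ≤ f S + f T

/-- The smallest value `min_j f(j)` on a singleton (for `n ≥ 1`). -/
noncomputable def minSingleton {n : ℕ} (f : Finset (Fin n) → ℝ) : ℝ :=
  ⨅ j : Fin n, f {j}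

/-- The total curvature `1 - min_j f(j | V \ j) / f(j)`
(for `n ≥ 1` and `f` positive on singletons). -/
noncomputable def curvature {n : ℕ} (f : Finset (Fin n) → ℝ) : ℝ :=
  1 - ⨅ j : Fin n, (f Finset.univ - f (Finset.univ.erase j)) / f {j}

/-- A pair of polymatroid functions, positive on singletons, the first (the cost function) having
total curvature `κ`. -/
structure IsCostGainPair {n : ℕ} (κ : ℝ) (f g : Finset (Fin n) → ℝ) : Prop where
  polymatroid_cost : IsPolymatroid f
  polymatroid_gain : IsPolymatroid g
  cost_pos : ∀ j : Fin n, 0 < f {j}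
  gain_pos : ∀ j : Fin n, 0 < g {j}
  curvature_cost : curvature f = κ

/-- The size of an instance: `n + ⌈log₂ (f(V) / min_j f(j))⌉ + ⌈log₂ (g(V) / min_j g(j))⌉`. -/
noncomputable def instanceSize {n : ℕ} (f g : Finset (Fin n) → ℝ) : ℕ :=
  n + ⌈Real.logb 2 (f Finset.univ / minSingleton f)⌉₊
    + ⌈Real.logb 2 (g Finset.univ / minSingleton g)⌉₊

/-- `X` is an optimizer of `min {f(X) | g(X) ≥ c}`. -/
def IsOptSCSC {n : ℕ} (f g : Finset (Fin n) → ℝ) (c : ℝ) (X : Finset (Fin n)) : Prop :=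
  c ≤ g X ∧ ∀ Y : Finset (Fin n), c ≤ g Y → f X ≤ f Y

/-- `X` is an optimizer of `max {g(X) | f(X) ≤ b}`. -/
def IsOptSCSK {n : ℕ} (f g : Finset (Fin n) → ℝ) (b : ℝ) (X : Finset (Fin n)) : Prop :=
  f X ≤ b ∧ ∀ Y : Finset (Fin n), f Y ≤ b → g Y ≤ g X

/-- `X` is a `[σ, ρ]` bi-criterion solution of `min {f(X) | g(X) ≥ c}`. -/
def IsApproxSCSC {n : ℕ} (σ ρ : ℝ) (f g : Finset (Fin n) → ℝ) (c : ℝ)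
    (X : Finset (Fin n)) : Prop :=
  (∀ Xopt : Finset (Fin n), IsOptSCSC f g c Xopt → f X ≤ σ * f Xopt) ∧ ρ * c ≤ g X

/-- `X` is a `[ρ, σ]` bi-criterion solution of `max {g(X) | f(X) ≤ b}`. -/
def IsApproxSCSK {n : ℕ} (ρ σ : ℝ) (f g : Finset (Fin n) → ℝ) (b : ℝ)
    (X : Finset (Fin n)) : Prop :=
  (∀ Xopt : Finset (Fin n), IsOptSCSK f g b Xopt → ρ * g Xopt ≤ g X) ∧ f X ≤ σ * b

/-- An adaptive, possibly randomized, computationally unbounded algorithm on the ground set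
`Fin n` with value oracles for two set functions. It stops with an output set, or asks for the
value of one of the two functions at a set and continues in a way that depends on the answer, or
tosses a fair coin. Deterministic algorithms are those without coin tosses. -/
inductive OracleAlg (n : ℕ) : Type
  | output (X : Finset (Fin n)) : OracleAlg n
  | queryCost (S : Finset (Fin n)) (next : ℝ → OracleAlg n) : OracleAlg n
  | queryGain (S : Finset (Fin n)) (next : ℝ → OracleAlg n) : OracleAlg n
  | coin (heads tails : OracleAlg n) : OracleAlg n

/-- The number of value queries made when the oracles are `f` and `g`
(in the worst case over the coin tosses). -/
noncomputable def OracleAlg.queries {n : ℕ} (f g : Finset (Fin n) → ℝ) : OracleAlg n → ℕ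
  | .output _ => 0
  | .queryCost S next => (next (f S)).queries f g + 1
  | .queryGain S next => (next (g S)).queries f g + 1
  | .coin heads tails => max (heads.queries f g) (tails.queries f g)

open Classical in
/-- The probability, over the coin tosses, that the output satisfies `P` when the oracles are
`f` and `g`. -/
noncomputable def OracleAlg.prob {n : ℕ} (f g : Finset (Fin n) → ℝ)
    (P : Finset (Fin n) → Prop) : OracleAlg n → ℝ
  | .output X => if P X then 1 else 0
  | .queryCost S next => (next (f S)).prob f g P
  | .queryGain S next => (next (g S)).prob f g P
  | .coin heads tails => (heads.prob f g P + tails.prob f g P) / 2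

/-- The algorithm `A`, which receives the cover parameter `c` and oracle access to `f` and `g`, is
a `[σ, ρ]` bi-criterion algorithm, with success probability at least `δ` and at most `p(size)`
queries, for the problem `min {f(X) | g(X) ≥ c}` on all non-degenerate instances on `Fin n` whose
cost function has curvature `κ`. -/
def IsBicriterionAlgSCSC {n : ℕ} (κ : ℝ) (p : Polynomial ℕ) (δ σ ρ : ℝ)
    (A : ℝ → OracleAlg n) : Prop :=
  ∀ (f g : Finset (Fin n) → ℝ) (c : ℝ), IsCostGainPair κ f g →
    minSingleton g ≤ c → c ≤ g Finset.univ →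
      (A c).queries f g ≤ p.eval (instanceSize f g) ∧
        δ ≤ (A c).prob f g (IsApproxSCSC σ ρ f g c)

/-- The algorithm `A`, which receives the budget `b` and oracle access to `f` and `g`, is
a `[ρ, σ]` bi-criterion algorithm, with success probability at least `δ` and at most `p(size)`
queries, for the problem `max {g(X) | f(X) ≤ b}` on all non-degenerate instances on `Fin n` whose
cost function has curvature `κ`. -/
def IsBicriterionAlgSCSK {n : ℕ} (κ : ℝ) (p : Polynomial ℕ) (δ ρ σ : ℝ)
    (A : ℝ → OracleAlg n) : Prop :=
  ∀ (f g : Finset (Fin n) → ℝ) (b : ℝ), IsCostGainPair κ f g →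
    minSingleton f ≤ b → b ≤ f Finset.univ →
      (A b).queries f g ≤ p.eval (instanceSize f g) ∧
        δ ≤ (A b).prob f g (IsApproxSCSK ρ σ f g b)

end SubmodularHardness

/-! A cheap random set `R` of size `α = ⌊√n⌋` is hidden in an otherwise symmetric cost, with
cardinality as gain. The cost differs from the unstructured one (`R = ∅`) at a query only if some
set of size at most `α`, fixed by the query, meets `R` in more than `β` points. A union bound over
`(β + 1)`-subsets, together with `α² ≤ n`, gives this probability at most `1 / (β + 1)!`
(`factorial_mul_card_filter_inter_le`).

Hence an algorithm whose run on the unstructured cost makes `q` queries notices at most a fraction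
`(q + 1) / (β + 1)!` of the sets `R`, counting its output as a query (`OracleAlg.sum_prob_le`).
Success forces noticing: `R` costs at most `κβ + (1 - κ)α`, whereas `ρα` elements cost at least `ρα`
without structure, and the assumed bound on `σ / ρ` separates the two. With `β` about `n ^ ε` (for
`ε ≤ 1/2`), `(β + 1)!` outgrows every polynomial in `n`. -/

namespace SubmodularHardness

open Finset

/-! ### Closure properties of polymatroid functions -/

section Polymatroid

variable {n : ℕ}

theorem IsPolymatroid.add {f g : Finset (Fin n) → ℝ} (hf : IsPolymatroid f)
    (hg : IsPolymatroid g) : IsPolymatroid fun X ↦ f X + g X where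
  empty := by simp [hf.empty, hg.empty]
  mono S T h := add_le_add (hf.mono S T h) (hg.mono S T h)
  submodular S T := by linarith [hf.submodular S T, hg.submodular S T]

theorem IsPolymatroid.const_mul {f : Finset (Fin n) → ℝ} (hf : IsPolymatroid f) {a : ℝ}
    (ha : 0 ≤ a) : IsPolymatroid fun X ↦ a * f X where
  empty := by simp [hf.empty]
  mono S T h := mul_le_mul_of_nonneg_left (hf.mono S T h) ha
  submodular S T := by
    have := mul_le_mul_of_nonneg_left (hf.submodular S T) ha
    linarith

theorem IsPolymatroid.min_const {f : Finset (Fin n) → ℝ} (hf : IsPolymatroid f) {a : ℝ}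
    (ha : 0 ≤ a) : IsPolymatroid fun X ↦ min a (f X) where
  empty := by simp [hf.empty, ha]
  mono S T h := min_le_min_left a (hf.mono S T h)
  submodular S T := by
    have h := hf.submodular S T
    have h1 := hf.mono _ _ (inter_subset_left : S ∩ T ⊆ S)
    have h2 := hf.mono _ _ (inter_subset_right : S ∩ T ⊆ T)
    have h3 := hf.mono _ _ (subset_union_left : S ⊆ S ∪ T)
    have h4 := hf.mono _ _ (subset_union_right : T ⊆ S ∪ T)
    -- Once it is known which of the four truncations bind, submodularity and monotonicity of `f`
    -- settle the inequality linearly.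
    rcases min_cases a (f S) with ⟨e1, _⟩ | ⟨e1, _⟩ <;>
    rcases min_cases a (f T) with ⟨e2, _⟩ | ⟨e2, _⟩ <;>
    rcases min_cases a (f (S ∪ T)) with ⟨e3, _⟩ | ⟨e3, _⟩ <;>
    rcases min_cases a (f (S ∩ T)) with ⟨e4, _⟩ | ⟨e4, _⟩ <;>
    linarith

theorem isPolymatroid_card_inter (R : Finset (Fin n)) :
    IsPolymatroid fun X ↦ ((X ∩ R).card : ℝ) where
  empty := by simp
  mono S T h := by exact_mod_cast card_le_card (inter_subset_inter_right h)
  submodular S T := by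
    have h := card_union_add_card_inter (S ∩ R) (T ∩ R)
    rw [← union_inter_distrib_right, ← inter_inter_distrib_right] at h
    exact_mod_cast h.le

theorem isPolymatroid_card : IsPolymatroid fun X : Finset (Fin n) ↦ (X.card : ℝ) := by
  simpa using isPolymatroid_card_inter (univ : Finset (Fin n))

theorem isPolymatroid_card_sdiff (R : Finset (Fin n)) :
    IsPolymatroid fun X ↦ ((X \ R).card : ℝ) := by
  simpa only [sdiff_eq_inter_compl] using isPolymatroid_card_inter Rᶜ

end Polymatroid

/-- The cost function that hides the cheap set `R`: a convex combination of a truncated rank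
function and the cardinality. -/
noncomputable def hidingCost {n : ℕ} (κ : ℝ) (α β : ℕ) (R X : Finset (Fin n)) : ℝ :=
  κ * min (α : ℝ) ((X \ R).card + min (β : ℝ) (X ∩ R).card) + (1 - κ) * X.card

/-! ### The hiding cost: curvature, size, and what a query reveals -/

section HidingCost

variable {n : ℕ} {κ : ℝ} {α β : ℕ}

theorem isPolymatroid_hidingCost (h0 : 0 ≤ κ) (h1 : κ ≤ 1) (R : Finset (Fin n)) :
    IsPolymatroid (hidingCost κ α β R) :=
  ((((isPolymatroid_card_sdiff R).add ((isPolymatroid_card_inter R).min_const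
    β.cast_nonneg)).min_const α.cast_nonneg).const_mul h0).add
      (isPolymatroid_card.const_mul (sub_nonneg.2 h1))

theorem hidingCost_empty (X : Finset (Fin n)) :
    hidingCost κ α β ∅ X = κ * min (α : ℝ) X.card + (1 - κ) * X.card := by
  simp [hidingCost]

theorem hidingCost_self_le (h0 : 0 ≤ κ) (R : Finset (Fin n)) :
    hidingCost κ α β R R ≤ κ * β + (1 - κ) * R.card := by
  unfold hidingCost
  gcongr
  simp

theorem hidingCost_singleton (hα : 1 ≤ α) (hβ : 1 ≤ β) (R : Finset (Fin n)) (j : Fin n) :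
    hidingCost κ α β R {j} = 1 := by
  have hα' : (1 : ℝ) ≤ α := by exact_mod_cast hα
  have hβ' : (1 : ℝ) ≤ β := by exact_mod_cast hβ
  by_cases hj : j ∈ R
  · have e1 : ({j} : Finset (Fin n)) \ R = ∅ := by simpa using hj
    have e2 : ({j} : Finset (Fin n)) ∩ R = {j} := by simpa using hj
    simp [hidingCost, e1, e2, hα', hβ']
  · have e1 : ({j} : Finset (Fin n)) \ R = {j} := by simpa using hj
    have e2 : ({j} : Finset (Fin n)) ∩ R = ∅ := singleton_inter_of_notMem hj
    simp [hidingCost, e1, e2, hα']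

/-- The elements outside `R` already saturate the truncation at `α`, so `R` becomes invisible. -/
theorem hidingCost_of_le_card_sdiff {R X : Finset (Fin n)} (h : α ≤ (X \ R).card) :
    hidingCost κ α β R X = κ * α + (1 - κ) * X.card := by
  have h' : (α : ℝ) ≤ (X \ R).card + min (β : ℝ) (X ∩ R).card := by
    have h1 : (α : ℝ) ≤ (X \ R).card := by exact_mod_cast h
    have h2 : (0 : ℝ) ≤ min (β : ℝ) (X ∩ R).card := by positivity
    linarith
  rw [hidingCost, min_eq_left h']

theorem hidingCost_univ {R : Finset (Fin n)} (hR : R.card ≤ α) (hn : 2 * α + 1 ≤ n) :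
    hidingCost κ α β R univ = κ * α + (1 - κ) * n := by
  rw [hidingCost_of_le_card_sdiff, card_univ, Fintype.card_fin]
  have := le_card_sdiff R univ
  rw [card_univ, Fintype.card_fin] at this
  omega

/-- The `+ 1` in `hn` keeps the truncation saturated after one deletion. Every marginal cost at the
top is then `1 - κ`, so the curvature is exactly `κ`. -/
theorem hidingCost_erase {R : Finset (Fin n)} (hR : R.card ≤ α) (hn : 2 * α + 1 ≤ n)
    (j : Fin n) : hidingCost κ α β R (univ.erase j) = κ * α + (1 - κ) * (n - 1) := by
  have hc : (univ.erase j).card = n - 1 := by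
    rw [card_erase_of_mem (mem_univ j), card_univ, Fintype.card_fin]
  rw [hidingCost_of_le_card_sdiff, hc, Nat.cast_sub (by omega), Nat.cast_one]
  have := le_card_sdiff R (univ.erase j)
  omega

theorem minSingleton_hidingCost (hα : 1 ≤ α) (hβ : 1 ≤ β) (hn : 0 < n) (R : Finset (Fin n)) :
    minSingleton (hidingCost κ α β R) = 1 := by
  have : Nonempty (Fin n) := ⟨⟨0, hn⟩⟩
  simp [minSingleton, hidingCost_singleton hα hβ]

theorem minSingleton_card (hn : 0 < n) :
    minSingleton (fun X : Finset (Fin n) ↦ (X.card : ℝ)) = 1 := by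
  have : Nonempty (Fin n) := ⟨⟨0, hn⟩⟩
  simp [minSingleton]

theorem isCostGainPair_hidingCost (h0 : 0 ≤ κ) (h1 : κ ≤ 1) (hα : 1 ≤ α) (hβ : 1 ≤ β)
    (hn : 2 * α + 1 ≤ n) {R : Finset (Fin n)} (hR : R.card ≤ α) :
    IsCostGainPair κ (hidingCost κ α β R) fun X ↦ (X.card : ℝ) where
  polymatroid_cost := isPolymatroid_hidingCost h0 h1 R
  polymatroid_gain := isPolymatroid_card
  cost_pos j := by rw [hidingCost_singleton hα hβ]; exact one_pos
  gain_pos j := by simp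
  curvature_cost := by
    have : Nonempty (Fin n) := ⟨⟨0, by omega⟩⟩
    have h : ∀ j : Fin n, (hidingCost κ α β R univ - hidingCost κ α β R (univ.erase j)) /
        hidingCost κ α β R {j} = 1 - κ := fun j ↦ by
      rw [hidingCost_univ hR hn, hidingCost_erase hR hn, hidingCost_singleton hα hβ]
      ring
    simp only [curvature, h, ciInf_const]
    ring

theorem ceil_logb_two_le {x : ℝ} (hx : 0 < x) (hxn : x ≤ n) : ⌈Real.logb 2 x⌉₊ ≤ n := by
  rw [Nat.ceil_le, Real.logb_le_iff_le_rpow one_lt_two hx, Real.rpow_natCast]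
  exact hxn.trans (by exact_mod_cast Nat.lt_two_pow_self.le)

/-- Singletons have value `1` and both total values are at most `n`, so a query bound in the size is
a polynomial bound in `n`. -/
theorem instanceSize_hidingCost_le (h0 : 0 ≤ κ) (h1 : κ ≤ 1) (hα : 1 ≤ α) (hβ : 1 ≤ β)
    (hn : 2 * α + 1 ≤ n) {R : Finset (Fin n)} (hR : R.card ≤ α) :
    instanceSize (hidingCost κ α β R) (fun X ↦ (X.card : ℝ)) ≤ 3 * n := by
  have hα' : (1 : ℝ) ≤ α := by exact_mod_cast hα
  have hn' : 2 * (α : ℝ) + 1 ≤ n := by exact_mod_cast hn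
  have hc : ⌈Real.logb 2 (n : ℝ)⌉₊ ≤ n := ceil_logb_two_le (by linarith) le_rfl
  have hf : ⌈Real.logb 2 (κ * α + (1 - κ) * n)⌉₊ ≤ n :=
    ceil_logb_two_le (by nlinarith) (by nlinarith)
  rw [instanceSize, minSingleton_hidingCost hα hβ (by omega), minSingleton_card (by omega),
    hidingCost_univ hR hn, card_univ, Fintype.card_fin, div_one, div_one]
  omega

/-- A set distinguishes the hidden cost from the unstructured one only if a part of it of size at
most `α`, chosen independently of the hidden set, meets the hidden set in more than `β` points. -/
theorem exists_subset_hidingCost_ne (S : Finset (Fin n)) :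
    ∃ S' : Finset (Fin n), S'.card ≤ α ∧
      ∀ R, hidingCost κ α β R S ≠ hidingCost κ α β ∅ S → β + 1 ≤ (S' ∩ R).card := by
  rcases le_total S.card α with hS | hS
  · refine ⟨S, hS, fun R h ↦ ?_⟩
    by_contra hlt
    have hle : ((S ∩ R).card : ℝ) ≤ β := by exact_mod_cast (by omega : (S ∩ R).card ≤ β)
    have hc : ((S \ R).card : ℝ) + (S ∩ R).card = S.card := by
      exact_mod_cast card_sdiff_add_card_inter S R
    exact h (by rw [hidingCost_empty, hidingCost, min_eq_right hle, hc])
  -- Any `α`-subset works: if it meets `R` in at most `β` points, it alone saturates the truncation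
  -- under both costs.
  · obtain ⟨S', hsub, hS'⟩ := exists_subset_card_eq hS
    refine ⟨S', hS'.le, fun R h ↦ ?_⟩
    by_contra hlt
    have hle : ((S' ∩ R).card : ℝ) ≤ β := by exact_mod_cast (by omega : (S' ∩ R).card ≤ β)
    have hc : ((S' \ R).card : ℝ) + (S' ∩ R).card = α := by
      exact_mod_cast (card_sdiff_add_card_inter S' R).trans hS'
    have h1 : ((S' \ R).card : ℝ) ≤ (S \ R).card := by
      exact_mod_cast card_le_card (sdiff_subset_sdiff hsub le_rfl)
    have h2 : ((S' ∩ R).card : ℝ) ≤ (S ∩ R).card := by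
      exact_mod_cast card_le_card (inter_subset_inter_right hsub)
    have h3 : (α : ℝ) ≤ (S \ R).card + min (β : ℝ) (S ∩ R).card := by
      have := le_min hle h2
      linarith
    have hS'' : (α : ℝ) ≤ S.card := by exact_mod_cast hS
    exact h (by rw [hidingCost_empty, hidingCost, min_eq_left h3, min_eq_left hS''])

end HidingCost

/-! ### Intersections of a fixed set with a random set -/

section Counting

/-- Factor by factor, `(a - k)² ≤ n - k`, since `(a - k)² + k ≤ a²` for `k ≤ a`. -/
theorem descFactorial_sq_le {a n : ℕ} (h : a ^ 2 ≤ n) (k : ℕ) :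
    a.descFactorial k ^ 2 ≤ n.descFactorial k := by
  induction k with
  | zero => simp
  | succ k ih =>
    rw [Nat.descFactorial_succ, Nat.descFactorial_succ, mul_pow]
    refine Nat.mul_le_mul ?_ ih
    rcases le_total a k with hk | hk
    · simp [Nat.sub_eq_zero_of_le hk]
    · obtain ⟨d, rfl⟩ := Nat.exists_eq_add_of_le hk
      rw [Nat.add_sub_cancel_left]
      refine Nat.le_sub_of_add_le (le_trans ?_ h)
      nlinarith [Nat.le_self_pow two_ne_zero k]

theorem factorial_mul_choose_sq_le {a n : ℕ} (h : a ^ 2 ≤ n) (k : ℕ) :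
    k.factorial * a.choose k ^ 2 ≤ n.choose k := by
  have := descFactorial_sq_le h k
  rw [Nat.descFactorial_eq_factorial_mul_choose, Nat.descFactorial_eq_factorial_mul_choose] at this
  exact Nat.le_of_mul_le_mul_left (by linarith) k.factorial_pos

theorem card_filter_subset_powersetCard_le {n : ℕ} (a : ℕ) (T : Finset (Fin n)) :
    #{R ∈ powersetCard a (univ : Finset (Fin n)) | T ⊆ R} ≤
      (n - T.card).choose (a - T.card) := by
  have hT : (n - T.card).choose (a - T.card) = #(powersetCard (a - T.card) Tᶜ) := by
    rw [card_powersetCard, card_compl, Fintype.card_fin]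
  rw [hT]
  refine card_le_card_of_injOn (· \ T) (fun R hR ↦ ?_) (fun R hR R' hR' h ↦ ?_)
  · simp only [mem_coe, mem_filter, mem_powersetCard, subset_univ, true_and] at hR
    refine mem_coe.2 <| mem_powersetCard.2 ⟨fun x hx ↦ mem_compl.2 (mem_sdiff.1 hx).2, ?_⟩
    rw [card_sdiff_of_subset hR.2, hR.1]
  · simp only [mem_coe, mem_filter] at hR hR'
    rw [← sdiff_union_of_subset hR.2, ← sdiff_union_of_subset hR'.2]
    exact congrArg (· ∪ T) h

/-- A random set of size `a ≤ √n` meets a fixed set of size at most `a` in `k` or more points with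
probability at most `1 / k!`. -/
theorem factorial_mul_card_filter_inter_le {n a : ℕ} (h : a ^ 2 ≤ n) (k : ℕ)
    {S : Finset (Fin n)} (hS : S.card ≤ a) :
    k.factorial * #{R ∈ powersetCard a (univ : Finset (Fin n)) | k ≤ (S ∩ R).card} ≤
      n.choose a := by
  rcases lt_or_ge a k with hk | hk
  · rw [filter_false_of_mem]
    · simp
    · intro R _ hc
      have := card_le_card (inter_subset_left : S ∩ R ⊆ S)
      omega
  -- Union bound over the `k`-subsets `T` of `S` contained in `R`.
  have hsub : {R ∈ powersetCard a (univ : Finset (Fin n)) | k ≤ (S ∩ R).card} ⊆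
      (powersetCard k S).biUnion
        fun T ↦ {R ∈ powersetCard a (univ : Finset (Fin n)) | T ⊆ R} := by
    intro R hR
    obtain ⟨hR, hc⟩ := mem_filter.1 hR
    obtain ⟨T, hT, hTc⟩ := exists_subset_card_eq hc
    exact mem_biUnion.2 ⟨T, mem_powersetCard.2 ⟨hT.trans inter_subset_left, hTc⟩,
      mem_filter.2 ⟨hR, hT.trans inter_subset_right⟩⟩
  have hcard : #{R ∈ powersetCard a (univ : Finset (Fin n)) | k ≤ (S ∩ R).card} ≤
      a.choose k * (n - k).choose (a - k) := by
    refine ((card_le_card hsub).trans (card_biUnion_le_card_mul _ _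
      ((n - k).choose (a - k)) fun T hT ↦ ?_)).trans ?_
    · have := card_filter_subset_powersetCard_le a T
      rwa [(mem_powersetCard.1 hT).2] at this
    · rw [card_powersetCard]
      exact Nat.mul_le_mul_right _ (Nat.choose_le_choose k hS)
  have han : a ≤ n := (Nat.le_self_pow two_ne_zero a).trans h
  have hmul : n.choose a * a.choose k = n.choose k * (n - k).choose (a - k) :=
    Nat.choose_mul hk
  -- The extra factor `a.choose k` allows `hmul` to be used without division.
  refine Nat.le_of_mul_le_mul_right ?_ (Nat.choose_pos hk : 0 < a.choose k)
  calc k.factorial * #{R ∈ powersetCard a (univ : Finset (Fin n)) | k ≤ (S ∩ R).card} *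
        a.choose k
      ≤ k.factorial * (a.choose k * (n - k).choose (a - k)) * a.choose k := by gcongr
    _ = k.factorial * a.choose k ^ 2 * (n - k).choose (a - k) := by ring
    _ ≤ n.choose k * (n - k).choose (a - k) :=
        Nat.mul_le_mul_right _ (factorial_mul_choose_sq_le h k)
    _ = n.choose a * a.choose k := hmul.symm

end Counting

/-! ### Oracle algorithms against a family of costs -/

section Algorithms

variable {n : ℕ}

theorem OracleAlg.prob_nonneg (f g : Finset (Fin n) → ℝ) (P : Finset (Fin n) → Prop)
    (A : OracleAlg n) : 0 ≤ A.prob f g P := by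
  induction A with
  | output X => simp only [OracleAlg.prob]; split_ifs <;> norm_num
  | queryCost S next ih => exact ih _
  | queryGain S next ih => exact ih _
  | coin A B ihA ihB => simp only [OracleAlg.prob]; linarith

theorem OracleAlg.prob_le_one (f g : Finset (Fin n) → ℝ) (P : Finset (Fin n) → Prop)
    (A : OracleAlg n) : A.prob f g P ≤ 1 := by
  induction A with
  | output X => simp only [OracleAlg.prob]; split_ifs <;> norm_num
  | queryCost S next ih => exact ih _
  | queryGain S next ih => exact ih _
  | coin A B ihA ihB => simp only [OracleAlg.prob]; linarith

theorem OracleAlg.prob_eq_zero (f g : Finset (Fin n) → ℝ) {P : Finset (Fin n) → Prop}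
    (hP : ∀ X, ¬ P X) (A : OracleAlg n) : A.prob f g P = 0 := by
  induction A with
  | output X => simp [OracleAlg.prob, hP]
  | queryCost S next ih => exact ih _
  | queryGain S next ih => exact ih _
  | coin A B ihA ihB => simp [OracleAlg.prob, ihA, ihB]

open Classical in
/-- If every set distinguishes `f` from at most `M` members of a finite family of cost functions,
and only distinguishing sets are successful outputs, then the expected number of members on which
an algorithm succeeds is at most `M` times its number of queries plus one. -/
theorem OracleAlg.sum_prob_le {ι : Type*} (s : Finset ι) (F : ι → Finset (Fin n) → ℝ)
    (f g : Finset (Fin n) → ℝ) (P : ι → Finset (Fin n) → Prop) (M : ℕ)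
    (hM : ∀ S, #{i ∈ s | F i S ≠ f S} ≤ M) (hP : ∀ i ∈ s, ∀ X, P i X → F i X ≠ f X)
    (A : OracleAlg n) :
    ∑ i ∈ s, A.prob (F i) g (P i) ≤ ((A.queries f g + 1 : ℕ) : ℝ) * M := by
  induction A with
  | output X =>
    simp only [OracleAlg.prob, OracleAlg.queries, sum_boole]
    -- The output acts as one last query, which is the `+ 1` in the bound.
    have h : #{i ∈ s | P i X} ≤ M :=
      (card_le_card fun i hi ↦ mem_filter.2
        ⟨(mem_filter.1 hi).1, hP i (mem_filter.1 hi).1 X (mem_filter.1 hi).2⟩).trans (hM X)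
    simpa using h
  | queryCost S next ih =>
    -- Members that answer like `f` follow the same branch; each of the at most `M` others
    -- contributes at most `1`.
    have h : ∀ i ∈ s, (OracleAlg.queryCost S next).prob (F i) g (P i) ≤
        (next (f S)).prob (F i) g (P i) + if F i S ≠ f S then 1 else 0 := fun i _ ↦ by
      simp only [OracleAlg.prob]
      split_ifs with hi
      · linarith [(next (F i S)).prob_le_one (F i) g (P i),
          (next (f S)).prob_nonneg (F i) g (P i)]
      · rw [not_not.1 hi, add_zero]
    refine (sum_le_sum h).trans ?_
    rw [sum_add_distrib, sum_boole]
    have h1 := ih (f S)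
    have h2 : ((#{i ∈ s | F i S ≠ f S} : ℕ) : ℝ) ≤ M := by exact_mod_cast hM S
    simp only [OracleAlg.queries]
    push_cast at h1 ⊢
    linarith
  | queryGain S next ih =>
    refine (ih (g S)).trans ?_
    simp only [OracleAlg.queries]
    gcongr
    omega
  | coin A B ihA ihB =>
    simp only [OracleAlg.prob, OracleAlg.queries]
    rw [← sum_div, sum_add_distrib]
    have h1 : ((A.queries f g + 1 : ℕ) : ℝ) * M ≤
        ((max (A.queries f g) (B.queries f g) + 1 : ℕ) : ℝ) * M := by
      gcongr; exact le_max_left _ _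
    have h2 : ((B.queries f g + 1 : ℕ) : ℝ) * M ≤
        ((max (A.queries f g) (B.queries f g) + 1 : ℕ) : ℝ) * M := by
      gcongr; exact le_max_right _ _
    linarith

/-- An algorithm with few queries that succeeds with probability at least `δ` for every hidden set
has a successful output that does not distinguish the hidden cost from the unstructured one. -/
theorem OracleAlg.exists_success_of_few_queries {κ : ℝ} {α β : ℕ} (hα : α ^ 2 ≤ n)
    (g : Finset (Fin n) → ℝ) (P : Finset (Fin n) → Finset (Fin n) → Prop) (A : OracleAlg n)
    {δ : ℝ} (hδ : ∀ R, R.card = α → δ ≤ A.prob (hidingCost κ α β R) g (P R))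
    (hA : ((A.queries (hidingCost κ α β ∅) g + 1 : ℕ) : ℝ) < δ * (β + 1).factorial) :
    ∃ R X : Finset (Fin n), R.card = α ∧ P R X ∧
      hidingCost κ α β R X = hidingCost κ α β ∅ X := by
  classical
  by_contra! hne
  set q := A.queries (hidingCost κ α β ∅) g
  set s := powersetCard α (univ : Finset (Fin n))
  have hs : ∀ R ∈ s, R.card = α := fun R hR ↦ (mem_powersetCard.1 hR).2
  have hcard : s.card = n.choose α := by simp [s]
  have hM : ∀ S, #{R ∈ s | hidingCost κ α β R S ≠ hidingCost κ α β ∅ S} ≤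
      n.choose α / (β + 1).factorial := fun S ↦ by
    obtain ⟨S', hS', h⟩ := exists_subset_hidingCost_ne (κ := κ) (α := α) (β := β) S
    rw [Nat.le_div_iff_mul_le (Nat.factorial_pos _), mul_comm]
    refine le_trans (Nat.mul_le_mul_left _ (card_le_card fun R hR ↦ ?_))
      (factorial_mul_card_filter_inter_le hα (β + 1) hS')
    rw [mem_filter] at hR ⊢
    exact ⟨hR.1, h R hR.2⟩
  have hsum := A.sum_prob_le s (hidingCost κ α β) (hidingCost κ α β ∅) g P _ hM
    fun R hR X hX ↦ hne R X (hs R hR) hX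
  have hlow : (n.choose α : ℝ) * δ ≤ ∑ R ∈ s, A.prob (hidingCost κ α β R) g (P R) := by
    rw [← hcard, ← nsmul_eq_mul]
    exact card_nsmul_le_sum _ _ _ fun R hR ↦ hδ R (hs R hR)
  have hdiv : ((n.choose α / (β + 1).factorial : ℕ) : ℝ) ≤
      (n.choose α : ℝ) / (β + 1).factorial := Nat.cast_div_le
  have hpos : (0 : ℝ) < n.choose α := by
    exact_mod_cast Nat.choose_pos ((Nat.le_self_pow two_ne_zero α).trans hα)
  have hfac : (0 : ℝ) < (β + 1).factorial := by exact_mod_cast Nat.factorial_pos _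
  have h1 : (n.choose α : ℝ) * δ ≤ ((q + 1 : ℕ) : ℝ) * (n.choose α / (β + 1).factorial) :=
    hlow.trans (hsum.trans (mul_le_mul_of_nonneg_left hdiv (Nat.cast_nonneg _)))
  rw [mul_div_assoc', le_div_iff₀ hfac] at h1
  nlinarith

end Algorithms

/-! ### Successful outputs expose the hidden set -/

section Hardness

variable {n : ℕ} {κ : ℝ} {α β : ℕ} {σ ρ : ℝ}

theorem le_hidingCost_empty (h0 : 0 ≤ κ) (h1 : κ ≤ 1) (hρ : ρ ≤ 1)
    {X : Finset (Fin n)} (hX : ρ * α ≤ X.card) : ρ * α ≤ hidingCost κ α β ∅ X := by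
  rw [hidingCost_empty]
  have h : ρ * α ≤ min (α : ℝ) X.card :=
    le_min (mul_le_of_le_one_left α.cast_nonneg hρ) hX
  nlinarith

/-- Without an optimizer the approximation guarantee on the cost would be vacuous. -/
theorem exists_isOptSCSC (f g : Finset (Fin n) → ℝ) {c : ℝ} {R : Finset (Fin n)}
    (hR : c ≤ g R) : ∃ X, IsOptSCSC f g c X := by
  classical
  obtain ⟨X, hX, h⟩ := exists_min_image {X | c ≤ g X} f ⟨R, by simpa using hR⟩
  exact ⟨X, by simpa using hX, fun Y hY ↦ h Y (by simpa using hY)⟩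

theorem exists_isOptSCSK (f g : Finset (Fin n) → ℝ) {b : ℝ} {R : Finset (Fin n)}
    (hR : f R ≤ b) : ∃ X, IsOptSCSK f g b X := by
  classical
  obtain ⟨X, hX, h⟩ := exists_max_image {X | f X ≤ b} g ⟨R, by simpa using hR⟩
  exact ⟨X, by simpa using hX, fun Y hY ↦ h Y (by simpa using hY)⟩

/-- A bi-criterion solution of the covering instance that hides `R` distinguishes the hidden cost
from the unstructured one. -/
theorem hidingCost_ne_of_isApproxSCSC (h0 : 0 ≤ κ) (h1 : κ ≤ 1) (hα : 1 ≤ α) (hρ0 : 0 < ρ)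
    (hρ : ρ ≤ 1) (hσ : σ * (κ * β + (1 - κ) * α) < ρ * α) {R X : Finset (Fin n)}
    (hR : R.card = α)
    (hX : IsApproxSCSC σ ρ (hidingCost κ α β R) (fun X ↦ (X.card : ℝ)) α X) :
    hidingCost κ α β R X ≠ hidingCost κ α β ∅ X := by
  intro heq
  obtain ⟨Z, hZ⟩ := exists_isOptSCSC (hidingCost κ α β R) (fun X ↦ (X.card : ℝ))
    (c := α) (R := R) (by simp [hR])
  have hle := hX.1 Z hZ
  have hZR := (hZ.2 R (by simp [hR])).trans (hidingCost_self_le h0 R)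
  rw [hR] at hZR
  have hlow := le_hidingCost_empty (β := β) h0 h1 hρ hX.2
  have hP := isPolymatroid_hidingCost (α := α) (β := β) h0 h1 R
  have hZ0 : 0 ≤ hidingCost κ α β R Z := by
    have := hP.mono ∅ Z (empty_subset Z)
    rwa [hP.empty] at this
  have hα' : (0 : ℝ) < α := by exact_mod_cast hα
  have hpos := mul_pos hρ0 hα'
  -- For `σ ≥ 0` the optimum is bounded by the cost of `R`; for `σ ≤ 0` the guarantee forces a
  -- nonpositive cost, below `ρ * α`.
  rcases le_total 0 σ with hs | hs
  · nlinarith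
  · nlinarith

/-- A bi-criterion solution of the knapsack instance that hides `R` distinguishes the hidden cost
from the unstructured one. -/
theorem hidingCost_ne_of_isApproxSCSK (h0 : 0 ≤ κ) (h1 : κ ≤ 1) (hρ0 : 0 < ρ)
    (hρ : ρ ≤ 1) (hσ : σ * (κ * β + (1 - κ) * α) < ρ * α) {R X : Finset (Fin n)}
    (hR : R.card = α)
    (hX : IsApproxSCSK ρ σ (hidingCost κ α β R) (fun X ↦ (X.card : ℝ))
      (κ * β + (1 - κ) * α) X) :
    hidingCost κ α β R X ≠ hidingCost κ α β ∅ X := by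
  intro heq
  have hRb := hidingCost_self_le (α := α) (β := β) h0 R
  rw [hR] at hRb
  obtain ⟨Z, hZ⟩ := exists_isOptSCSK _ (fun X ↦ (X.card : ℝ)) hRb
  have hRZ : (R.card : ℝ) ≤ Z.card := hZ.2 R hRb
  rw [hR] at hRZ
  have hlow := le_hidingCost_empty (β := β) h0 h1 hρ
    ((mul_le_mul_of_nonneg_left hRZ hρ0.le).trans (hX.1 Z hZ))
  linarith [hX.2]

variable {p : Polynomial ℕ} {δ : ℝ}

theorem polynomial_eval_mono (p : Polynomial ℕ) : Monotone fun m : ℕ ↦ p.eval m := by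
  intro a b h
  simp only [Polynomial.eval_eq_sum_range]
  gcongr

theorem not_isBicriterionAlgSCSC (h0 : 0 ≤ κ) (h1 : κ ≤ 1) (hα : 1 ≤ α) (hβ : 1 ≤ β)
    (hn : 2 * α + 1 ≤ n) (hαn : α ^ 2 ≤ n) (hδ : 0 < δ) (hρ0 : 0 < ρ)
    (hσ : σ * (κ * β + (1 - κ) * α) < ρ * α)
    (hp : ((p.eval (3 * n) + 1 : ℕ) : ℝ) < δ * (β + 1).factorial) (A : ℝ → OracleAlg n) :
    ¬ IsBicriterionAlgSCSC κ p δ σ ρ A := by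
  intro hA
  have hpair : ∀ R : Finset (Fin n), R.card ≤ α →
      IsCostGainPair κ (hidingCost κ α β R) fun X ↦ (X.card : ℝ) :=
    fun R ↦ isCostGainPair_hidingCost h0 h1 hα hβ hn
  have hempty : (∅ : Finset (Fin n)).card ≤ α := by simp
  rcases le_or_gt ρ 1 with hρ | hρ
  · have hinst : ∀ R : Finset (Fin n), R.card ≤ α → _ := fun R hR ↦
      hA (hidingCost κ α β R) (fun X ↦ (X.card : ℝ)) α (hpair R hR)
        (by rw [minSingleton_card (by omega)]; exact_mod_cast hα)
        (by rw [card_univ, Fintype.card_fin]; exact_mod_cast (by omega : α ≤ n))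
    -- The unstructured cost is itself a legitimate instance, so the query bound applies to it.
    have hq := (hinst ∅ hempty).1.trans (polynomial_eval_mono p
      (instanceSize_hidingCost_le h0 h1 hα hβ hn hempty))
    obtain ⟨R, X, hR, hX, heq⟩ := (A α).exists_success_of_few_queries hαn _
      (fun R ↦ IsApproxSCSC σ ρ (hidingCost κ α β R) (fun X ↦ (X.card : ℝ)) α)
      (fun R hR ↦ (hinst R hR.le).2)
      (lt_of_le_of_lt (by exact_mod_cast Nat.succ_le_succ hq) hp)
    exact hidingCost_ne_of_isApproxSCSC h0 h1 hα hρ0 hρ hσ hR hX heq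
  -- For `ρ > 1`, demanding `c = g(V) = n` leaves no acceptable output.
  · have h := (hA _ _ n (hpair ∅ hempty)
      (by rw [minSingleton_card (by omega)]; exact_mod_cast (by omega : 1 ≤ n))
      (by simp)).2
    rw [OracleAlg.prob_eq_zero] at h
    · exact hδ.not_ge h
    · intro X hX
      have hXn : (X.card : ℝ) ≤ n := by exact_mod_cast card_finset_fin_le X
      have hn0 : (0 : ℝ) < n := by exact_mod_cast (by omega : 0 < n)
      nlinarith [hX.2]

theorem not_isBicriterionAlgSCSK (h0 : 0 ≤ κ) (h1 : κ ≤ 1) (hβ : 1 ≤ β) (hβα : β ≤ α)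
    (hn : 2 * α + 1 ≤ n) (hαn : α ^ 2 ≤ n) (hδ : 0 < δ) (hρ0 : 0 < ρ)
    (hσ : σ * (κ * β + (1 - κ) * α) < ρ * α)
    (hp : ((p.eval (3 * n) + 1 : ℕ) : ℝ) < δ * (β + 1).factorial) (A : ℝ → OracleAlg n) :
    ¬ IsBicriterionAlgSCSK κ p δ ρ σ A := by
  intro hA
  have hα : 1 ≤ α := hβ.trans hβα
  have hpair : ∀ R : Finset (Fin n), R.card ≤ α →
      IsCostGainPair κ (hidingCost κ α β R) fun X ↦ (X.card : ℝ) :=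
    fun R ↦ isCostGainPair_hidingCost h0 h1 hα hβ hn
  have hempty : (∅ : Finset (Fin n)).card ≤ α := by simp
  have hβ' : (1 : ℝ) ≤ β := by exact_mod_cast hβ
  have hβα' : (β : ℝ) ≤ α := by exact_mod_cast hβα
  have hn' : 2 * (α : ℝ) + 1 ≤ n := by exact_mod_cast hn
  rcases le_or_gt ρ 1 with hρ | hρ
  · have hinst : ∀ R : Finset (Fin n), R.card ≤ α → _ := fun R hR ↦
      hA (hidingCost κ α β R) (fun X ↦ (X.card : ℝ)) (κ * β + (1 - κ) * α) (hpair R hR)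
        (by rw [minSingleton_hidingCost hα hβ (by omega)]; nlinarith)
        (by rw [hidingCost_univ hR hn]; nlinarith)
    have hq := (hinst ∅ hempty).1.trans (polynomial_eval_mono p
      (instanceSize_hidingCost_le h0 h1 hα hβ hn hempty))
    obtain ⟨R, X, hR, hX, heq⟩ := (A (κ * β + (1 - κ) * α)).exists_success_of_few_queries hαn _
      (fun R ↦ IsApproxSCSK ρ σ (hidingCost κ α β R) (fun X ↦ (X.card : ℝ))
        (κ * β + (1 - κ) * α))
      (fun R hR ↦ (hinst R hR.le).2)
      (lt_of_le_of_lt (by exact_mod_cast Nat.succ_le_succ hq) hp)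
    exact hidingCost_ne_of_isApproxSCSK h0 h1 hρ0 hρ hσ hR hX heq
  -- For `ρ > 1`, the budget `f(V)` makes `V` optimal, and no set has `ρ * n` elements.
  · have h := (hA _ _ (hidingCost κ α β ∅ univ) (hpair ∅ hempty)
      (by rw [minSingleton_hidingCost hα hβ (by omega), hidingCost_univ hempty hn]; nlinarith)
      le_rfl).2
    rw [OracleAlg.prob_eq_zero] at h
    · exact hδ.not_ge h
    · intro X hX
      have hXn : (X.card : ℝ) ≤ n := by exact_mod_cast card_finset_fin_le X
      have hopt := hX.1 univ ⟨le_rfl, fun Y _ ↦ isPolymatroid_card.mono Y univ (subset_univ Y)⟩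
      simp only [card_univ, Fintype.card_fin] at hopt
      nlinarith

end Hardness

/-! ### Choice of the parameters -/

section Asymptotics

open Filter Topology

/-- Both factors of `(p(m) / e^m) * (e^m / m!)` tend to `0`. -/
theorem eventually_polynomial_lt_factorial (p : Polynomial ℕ) {δ : ℝ} (hδ : 0 < δ) :
    ∀ᶠ m : ℕ in atTop, ((p.eval m : ℕ) : ℝ) < δ * m.factorial := by
  have h1 : Tendsto (fun m : ℕ ↦ (p.map (Nat.castRingHom ℝ)).eval (m : ℝ) / Real.exp m)
      atTop (𝓝 0) :=
    (Polynomial.tendsto_div_exp_atTop _).comp tendsto_natCast_atTop_atTop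
  have h2 := FloorSemiring.tendsto_pow_div_factorial_atTop (Real.exp 1)
  have h3 := h1.mul h2
  rw [zero_mul] at h3
  filter_upwards [h3.eventually (gt_mem_nhds hδ)] with m hm
  have hfac : (0 : ℝ) < m.factorial := by exact_mod_cast m.factorial_pos
  rw [← Real.exp_nat_mul, mul_one, div_mul_div_cancel₀ (Real.exp_ne_zero _), div_lt_iff₀ hfac,
    Polynomial.eval_natCast_map] at hm
  simpa using hm

theorem exists_hiding_parameters {ε : ℝ} (hε : 0 < ε) (p : Polynomial ℕ) {δ : ℝ} (hδ : 0 < δ) :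
    ∃ N : ℕ, ∀ n : ℕ, N ≤ n → ∃ α β : ℕ, 1 ≤ β ∧ β ≤ α ∧ 2 * α + 1 ≤ n ∧ α ^ 2 ≤ n ∧
      (n : ℝ) ^ (1 / 2 - ε) * β ≤ α ∧
      ((p.eval (3 * n) + 1 : ℕ) : ℝ) < δ * (β + 1).factorial := by
  -- The cap at `1 / 2` ensures `β ≤ α` for `β = ⌊α * n ^ (e - 1 / 2)⌋`.
  set e := min ε (1 / 2) with he
  have he0 : 0 < e := lt_min hε (by norm_num)
  have heε : e ≤ ε := min_le_left _ _
  have he2 : e ≤ 1 / 2 := min_le_right _ _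
  obtain ⟨K, hK⟩ := exists_nat_ge (1 / e)
  -- With `m = β + 1` one has `n ≤ (2 * m) ^ K`, so this polynomial in `m` dominates `p(3 * n) + 1`.
  obtain ⟨m₀, hm₀⟩ := eventually_atTop.1 (eventually_polynomial_lt_factorial
    (p.comp (3 * (2 * Polynomial.X) ^ K) + 1) hδ)
  have htend : Tendsto (fun n : ℕ ↦ (n : ℝ) ^ e) atTop atTop :=
    (tendsto_rpow_atTop he0).comp tendsto_natCast_atTop_atTop
  obtain ⟨N, hN⟩ := eventually_atTop.1 (htend.eventually_ge_atTop (2 * (m₀ + 2 : ℝ)))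
  -- From `n ≥ 9` comes `α ≥ 3`, hence `2 * α + 1 ≤ α ^ 2 ≤ n` and `√n ≤ 2 * α`.
  refine ⟨max N 9, fun n hn ↦ ?_⟩
  have hn9 : 9 ≤ n := (le_max_right _ _).trans hn
  have hne := hN n ((le_max_left _ _).trans hn)
  have hn1 : (1 : ℝ) ≤ n := by exact_mod_cast (by omega : 1 ≤ n)
  have hn0 : (0 : ℝ) < n := by linarith
  set α := Nat.sqrt n with hα
  have hα3 : 3 ≤ α := Nat.le_sqrt.2 (by omega)
  have hαn : α ^ 2 ≤ n := Nat.sqrt_le' n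
  have hα0 : (0 : ℝ) ≤ α := α.cast_nonneg
  set x : ℝ := α * (n : ℝ) ^ (e - 1 / 2) with hx
  have hx0 : 0 ≤ x := by positivity
  have hxα : x ≤ α :=
    mul_le_of_le_one_right hα0 (Real.rpow_le_one_of_one_le_of_nonpos hn1 (by linarith))
  have hhalf : (n : ℝ) ^ (1 / 2 : ℝ) ≤ 2 * α := by
    rw [← Real.sqrt_eq_rpow]
    have : Real.sqrt n ≤ α + 1 := by
      rw [Real.sqrt_le_left (by positivity)]
      exact_mod_cast (Nat.lt_succ_sqrt' n).le
    have : (3 : ℝ) ≤ α := by exact_mod_cast hα3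
    linarith
  have hxe : (n : ℝ) ^ e ≤ 2 * x := by
    calc (n : ℝ) ^ e = (n : ℝ) ^ (1 / 2 : ℝ) * (n : ℝ) ^ (e - 1 / 2) := by
          rw [← Real.rpow_add hn0]; congr 1; ring
      _ ≤ 2 * α * (n : ℝ) ^ (e - 1 / 2) := by gcongr
      _ = 2 * x := by rw [hx]; ring
  have hβx : ((⌊x⌋₊ : ℕ) : ℝ) ≤ x := Nat.floor_le hx0
  have hxβ : x < ((⌊x⌋₊ + 1 : ℕ) : ℝ) := by exact_mod_cast Nat.lt_floor_add_one x
  have hm : m₀ + 2 ≤ ⌊x⌋₊ := Nat.le_floor (by push_cast; linarith)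
  refine ⟨α, ⌊x⌋₊, by omega, ?_, by nlinarith, hαn, ?_, ?_⟩
  · exact_mod_cast hβx.trans hxα
  · calc (n : ℝ) ^ (1 / 2 - ε) * ⌊x⌋₊ ≤ (n : ℝ) ^ (1 / 2 - ε) * x := by gcongr
      _ = α * (n : ℝ) ^ (e - ε) := by
          rw [hx, mul_left_comm, ← Real.rpow_add hn0]; congr 2; ring
      _ ≤ α := mul_le_of_le_one_right hα0
          (Real.rpow_le_one_of_one_le_of_nonpos hn1 (by linarith))
  · have hnm : n ≤ (2 * (⌊x⌋₊ + 1)) ^ K := by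
      have hm1 : (1 : ℝ) ≤ 2 * ((⌊x⌋₊ + 1 : ℕ) : ℝ) := by push_cast; linarith
      have : (n : ℝ) ≤ (2 * ((⌊x⌋₊ + 1 : ℕ) : ℝ)) ^ K := by
        calc (n : ℝ) = ((n : ℝ) ^ e) ^ (1 / e) := by
              rw [← Real.rpow_mul hn0.le, mul_one_div_cancel he0.ne', Real.rpow_one]
          _ ≤ (2 * ((⌊x⌋₊ + 1 : ℕ) : ℝ)) ^ (1 / e) := by gcongr; linarith
          _ ≤ (2 * ((⌊x⌋₊ + 1 : ℕ) : ℝ)) ^ (K : ℝ) := Real.rpow_le_rpow_of_exponent_le hm1 hK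
          _ = _ := Real.rpow_natCast _ _
      exact_mod_cast this
    refine lt_of_le_of_lt ?_ (hm₀ (⌊x⌋₊ + 1) (by omega))
    have := polynomial_eval_mono p (Nat.mul_le_mul_left 3 hnm)
    simpa using this

end Asymptotics

/-- The ratio equals `r / (κ + r * (1 - κ))`, which increases with `r`; at `r = a / b` it is `a / (κ
* b + (1 - κ) * a)`. -/
theorem mul_lt_of_div_lt_ratio {κ r a b σ ρ : ℝ} (h0 : 0 < κ) (h1 : κ ≤ 1) (hr : 0 < r)
    (ha : 0 < a) (hb : 0 < b) (hrb : r * b ≤ a) (hρ : 0 < ρ)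
    (h : σ / ρ < r / (1 + (r - 1) * (1 - κ))) : σ * (κ * b + (1 - κ) * a) < ρ * a := by
  have hden : 0 < 1 + (r - 1) * (1 - κ) := by nlinarith
  have hden' : 0 < κ * b + (1 - κ) * a := by nlinarith
  have hle : r / (1 + (r - 1) * (1 - κ)) ≤ a / (κ * b + (1 - κ) * a) := by
    rw [div_le_div_iff₀ hden hden']
    nlinarith
  have := h.trans_le hle
  rw [div_lt_div_iff₀ hρ hden'] at this
  linarith

end SubmodularHardness

theorem mainTheorem2 (κ : ℝ) (hκ_pos : 0 < κ) (hκ_le : κ ≤ 1) (ε : ℝ) (hε : 0 < ε)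
    (p : Polynomial ℕ) (δ : ℝ) (hδ : 0 < δ) :
    ∃ N : ℕ, ∀ n : ℕ, N ≤ n → ∀ σ ρ : ℝ, 0 < ρ →
      σ / ρ < (n : ℝ) ^ (1 / 2 - ε) / (1 + ((n : ℝ) ^ (1 / 2 - ε) - 1) * (1 - κ)) →
      (∀ A : ℝ → SubmodularHardness.OracleAlg n,
        ¬ SubmodularHardness.IsBicriterionAlgSCSC κ p δ σ ρ A) ∧
      (∀ A : ℝ → SubmodularHardness.OracleAlg n,
        ¬ SubmodularHardness.IsBicriterionAlgSCSK κ p δ ρ σ A) := by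
  obtain ⟨N, hN⟩ := SubmodularHardness.exists_hiding_parameters hε p hδ
  refine ⟨N, fun n hn σ ρ hρ hσ ↦ ?_⟩
  obtain ⟨α, β, hβ, hβα, h2α, hαn, hr, hp⟩ := hN n hn
  have hn0 : (0 : ℝ) < n := by exact_mod_cast (by omega : 0 < n)
  have hα : 1 ≤ α := hβ.trans hβα
  have hratio := SubmodularHardness.mul_lt_of_div_lt_ratio hκ_pos hκ_le
    (Real.rpow_pos_of_pos hn0 _) (by exact_mod_cast hα) (by exact_mod_cast hβ) hr hρ hσ
  exact ⟨SubmodularHardness.not_isBicriterionAlgSCSC hκ_pos.le hκ_le hα hβ h2α hαn hδ hρ hratio hp,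
    SubmodularHardness.not_isBicriterionAlgSCSK hκ_pos.le hκ_le hβ hβα h2α hαn hδ hρ hratio hp⟩
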